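/- Let $1 \le k$ and let $\Sigma$ be a compact smooth $k$-dimensional manifold with nonempty boundary $\partial\Sigma$, and let $\varphi=(x^1,\dots,x^n):\Sigma\to\mathbb{R}^n$ be a smooth immersion with $\varphi(\Sigma)\subset \overline{B}{}^n=\{|x|\le 1\}$ and $\varphi(\partial\Sigma)\subset\partial B^n=\{|x|=1\}$ (a properly immersed submanifold of the unit ball). Equip $\Sigma$ with the induced metric $g$, let $\Delta_g$ be its Laplacian and $\nu$ the outward unit conormal along $\partial\Sigma$. Let $L$ be the Dirichlet-to-Neumann map: $Lu=\partial\hat u/\partial\nu$, where $\hat u\in C^\infty(\Sigma)$ satisfies $\Delta_g\hat u=0$ on $\Sigma$ and $\hat u=u$ on $\partial\Sigma$. Call a function $w\in C^\infty(\Sigma)$ an eigenfunction of the Dirichlet-to-Neumann map with eigenvalue $\sigma$ if $w$ is the harmonic extension of its boundary values and $L(w|_{\partial\Sigma})=\sigma\, w|_{\partial\Sigma}$ (the function $w=0$ is allowed). Then the following are equivalent: 1. $\Sigma$ is minimal (its mean curvature vector vanishes identically) and meets $\partial B^n$ orthogonally along $\partial\Sigma$, i.e. at each $p\in\partial\Sigma$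 the vector $d\varphi_p(\nu)$ is orthogonal to the tangent space of $\partial B^n$ at $\varphi(p)$; 2. each coordinate function $x^i$, $i=1,\dots,n$, is an eigenfunction of the Dirichlet-to-Neumann map with eigenvalue $1$. -/

import Mathlib

open scoped Manifold ContDiff RealInnerProductSpace

namespace SteklovBall

noncomputable section

/-- `ℝⁿ` with its Euclidean inner product. -/
abbrev Euc (n : ℕ) : Type := EuclideanSpace ℝ (Fin n)

section Coordinates

variable {k : ℕ} [NeZero k]

/-- The closed half space `{y ∈ ℝᵏ | 0 ≤ y 0}` in which the charts of a `k`-manifold with boundary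
take their values. -/
def halfSpace (k : ℕ) [NeZero k] : Set (Euc k) := Set.range (𝓡∂ k)

/-- The `i`-th partial derivative of a function on the closed half space (one-sided in the
direction transversal to the boundary, at boundary points). -/
def pd {F : Type*} [NormedAddCommGroup F] [NormedSpace ℝ F] (i : Fin k) (f : Euc k → F) :
    Euc k → F :=
  fun y => fderivWithin ℝ f (halfSpace k) y (EuclideanSpace.single i (1 : ℝ))

/-- The Christoffel symbols `Γˡᵢⱼ = ½ gˡᵐ (∂ᵢ gⱼₘ + ∂ⱼ gᵢₘ - ∂ₘ gᵢⱼ)` of a metric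
`G = (gᵢⱼ)` given in coordinates. -/
def christoffel (G : Euc k → Matrix (Fin k) (Fin k) ℝ) (y : Euc k) (l i j : Fin k) : ℝ :=
  (1 / 2 : ℝ) * ∑ m, (G y)⁻¹ l m *
    (pd i (fun z => G z j m) y + pd j (fun z => G z i m) y - pd m (fun z => G z i j) y)

/-- The Laplace-Beltrami operator (trace of the covariant Hessian) of a metric `G = (gᵢⱼ)` given in
coordinates: `Δ U = gⁱʲ (∂ᵢ ∂ⱼ U - Γˡᵢⱼ ∂ₗ U)`. -/
def coordLaplacian (G : Euc k → Matrix (Fin k) (Fin k) ℝ) (U : Euc k → ℝ) (y : Euc k) : ℝ :=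
  ∑ i, ∑ j, (G y)⁻¹ i j * (pd i (pd j U) y - ∑ l, christoffel G y l i j * pd l U y)

end Coordinates

section Submanifold

variable (k : ℕ) {n : ℕ} [NeZero k] {M : Type*} [TopologicalSpace M]
  [ChartedSpace (EuclideanHalfSpace k) M]

/-- The coordinate expression of a function on `M` in the preferred chart at `p`. -/
def inChart {F : Type*} (p : M) (f : M → F) : Euc k → F :=
  f ∘ (extChartAt (𝓡∂ k) p).symm

/-- The coordinates of `p` in the preferred chart at `p`. -/
def coordsAt (p : M) : Euc k := extChartAt (𝓡∂ k) p p

/-- The differential of `φ : M → ℝⁿ` at `p`. The tangent space `T_p M` is `ℝᵏ`, through the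
preferred chart at `p`. -/
def differential (φ : M → Euc n) (p : M) : Euc k →L[ℝ] Euc n :=
  mfderiv (𝓡∂ k) 𝓘(ℝ, Euc n) φ p

/-- The tangent plane `dφ (T_p M) ⊆ ℝⁿ` of an immersed submanifold. -/
def tangentPlane (φ : M → Euc n) (p : M) : Submodule ℝ (Euc n) :=
  LinearMap.range (differential k φ p).toLinearMap

/-- The metric induced by `φ` on `M`, in the preferred chart at `p`:
`gᵢⱼ = ⟨∂ᵢ φ, ∂ⱼ φ⟩`. -/
def inducedMetric (φ : M → Euc n) (p : M) : Euc k → Matrix (Fin k) (Fin k) ℝ :=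
  fun y => Matrix.of fun i j => ⟪pd i (inChart k p φ) y, pd j (inChart k p φ) y⟫

/-- The Laplacian at `p` of a function on `M`, for the metric induced by `φ`. -/
def laplacian (φ : M → Euc n) (u : M → ℝ) (p : M) : ℝ :=
  coordLaplacian (inducedMetric k φ p) (inChart k p u) (coordsAt k p)

/-- The coefficients `Aᵢⱼ = (∂ᵢ ∂ⱼ φ)^⊥` of the (vector-valued) second fundamental form at `p`,
in the preferred chart at `p`. -/
def secondFundamentalForm (φ : M → Euc n) (p : M) (i j : Fin k) : Euc n :=
  (tangentPlane k φ p)ᗮ.starProjection (pd i (pd j (inChart k p φ)) (coordsAt k p))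

/-- The mean curvature vector `H = gⁱʲ Aᵢⱼ` at `p`. -/
def meanCurvature (φ : M → Euc n) (p : M) : Euc n :=
  ∑ i, ∑ j, (inducedMetric k φ p (coordsAt k p))⁻¹ i j • secondFundamentalForm k φ p i j

/-- `φ` is minimal: its mean curvature vector vanishes identically. -/
def IsMinimal (φ : M → Euc n) : Prop := ∀ p : M, meanCurvature k φ p = 0

/-- `φ : M → ℝⁿ` is a properly immersed submanifold of the closed unit ball: a smooth immersion with
values in the closed ball that maps the boundary of `M` into the unit sphere.
(The manifold `M` is compact wherever this is used, so `φ` is automatically a proper map.) -/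
structure IsProperlyImmersedInBall (φ : M → Euc n) : Prop where
  smooth : ContMDiff (𝓡∂ k) 𝓘(ℝ, Euc n) ∞ φ
  injective_differential : ∀ p : M, Function.Injective (differential k φ p)
  mem_ball : ∀ p : M, φ p ∈ Metric.closedBall (0 : Euc n) 1
  boundary_mem_sphere : ∀ p ∈ (𝓡∂ k).boundary M, φ p ∈ Metric.sphere (0 : Euc n) 1

/-- `ν ∈ T_p M` is the outward unit conormal of `∂M` at the boundary point `p`, for the metric
induced by `φ`. In the preferred chart at `p` the tangent space of `∂M` is `{w | w 0 = 0}`, and the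
vectors pointing out of `M` are those with `w 0 < 0`. -/
structure IsOutwardConormal (φ : M → Euc n) (p : M) (ν : Euc k) : Prop where
  outward : ν 0 < 0
  normal : ∀ w : Euc k, w 0 = 0 → ⟪differential k φ p ν, differential k φ p w⟫ = 0
  unit : ‖differential k φ p ν‖ = 1

/-- The submanifold meets the unit sphere orthogonally: at each boundary point `p`, the outward unit
conormal is orthogonal to the tangent space `{v | ⟨v, φ p⟩ = 0}` of the sphere at `φ p`. -/
def MeetsSphereOrthogonally (φ : M → Euc n) : Prop :=
  ∀ p ∈ (𝓡∂ k).boundary M, ∀ ν : Euc k, IsOutwardConormal k φ p ν →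
    ∀ v : Euc n, ⟪v, φ p⟫ = 0 → ⟪differential k φ p ν, v⟫ = 0

/-- The derivative `du (ν)` of a function at `p` in the direction of a tangent vector. -/
def dirDeriv (u : M → ℝ) (p : M) (ν : Euc k) : ℝ := mfderiv (𝓡∂ k) 𝓘(ℝ, ℝ) u p ν

/-- Restriction of a function on `M` to the boundary. -/
def boundaryValues (w : M → ℝ) : (𝓡∂ k).boundary M → ℝ := fun p => w p

/-- `w` is a (smooth) harmonic extension of the function `u` on `∂M`, for the metric induced
by `φ`. -/
structure IsHarmonicExtension (φ : M → Euc n) (u : (𝓡∂ k).boundary M → ℝ) (w : M → ℝ) : Prop where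
  smooth : ContMDiff (𝓡∂ k) 𝓘(ℝ, ℝ) ∞ w
  harmonic : ∀ p : M, laplacian k φ w p = 0
  boundary_eq : boundaryValues k w = u

/-- The Dirichlet-to-Neumann map `L` of `M` with the metric induced by `φ`, through its graph:
`L u = f`, that is, `f` is the outward normal derivative of the harmonic extension of `u`. -/
def DirichletToNeumann (φ : M → Euc n) (u f : (𝓡∂ k).boundary M → ℝ) : Prop :=
  ∃ w : M → ℝ, IsHarmonicExtension k φ u w ∧
    ∀ (p : (𝓡∂ k).boundary M) (ν : Euc k), IsOutwardConormal k φ (p : M) ν →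
      dirDeriv k w (p : M) ν = f p

/-- The function `w` on `M` is an eigenfunction of the Dirichlet-to-Neumann map with eigenvalue `σ`:
`w` is the harmonic extension of its boundary values, and these satisfy `L u = σ u`.
(The zero function is allowed, as a member of the eigenspace.) -/
def IsSteklovEigenfunction (φ : M → Euc n) (σ : ℝ) (w : M → ℝ) : Prop :=
  IsHarmonicExtension k φ (boundaryValues k w) w ∧
    DirichletToNeumann k φ (boundaryValues k w) (σ • boundaryValues k w)

/-- The outward unit conormal exists and is unique wherever the differential is injective. -/
theorem existsUnique_isOutwardConormal (φ : M → Euc n) (p : M)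
    (h : Function.Injective (differential k φ p)) : ∃! ν : Euc k, IsOutwardConormal k φ p ν := by
  set D := differential k φ p with hD
  have hker : ∀ w, D w = 0 → w = 0 := fun w hw => h (by rw [hw, map_zero])
  obtain ⟨ν, hν⟩ : ∃ ν : Euc k, IsOutwardConormal k φ p ν := by
    let T : Submodule ℝ (Euc k) := LinearMap.ker (EuclideanSpace.proj (𝕜 := ℝ) (0 : Fin k)).toLinearMap
    let K : Submodule ℝ (Euc n) := T.map D.toLinearMap
    let e : Euc k := -EuclideanSpace.single 0 1
    obtain ⟨t, ht, hte⟩ : K.starProjection (D e) ∈ T.map D.toLinearMap :=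
      K.starProjection_apply_mem _
    have ht0 : t 0 = 0 := by simpa [T] using ht
    have hte' : D t = K.starProjection (D e) := hte
    have hr0 : (e - t) 0 = -1 := by simp [e, ht0]
    have hne : D (e - t) ≠ 0 := fun h0 => by
      have := hker _ h0
      rw [this] at hr0
      simp at hr0
    have hpos : 0 < ‖D (e - t)‖ := norm_pos_iff.2 hne
    refine ⟨‖D (e - t)‖⁻¹ • (e - t), ?_, ?_, ?_⟩
    · have : (‖D (e - t)‖⁻¹ • (e - t)) 0 = ‖D (e - t)‖⁻¹ * (e - t) 0 := rfl
      rw [this, hr0]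
      have := inv_pos.2 hpos
      linarith
    · intro w hw
      rw [← hD, map_smul, real_inner_smul_left]
      have hwK : D w ∈ K := ⟨w, by simpa [T] using hw, rfl⟩
      have : ⟪D (e - t), D w⟫ = 0 := by
        rw [map_sub, hte']
        exact K.starProjection_inner_eq_zero _ _ hwK
      rw [this, mul_zero]
    · rw [← hD, map_smul, norm_smul, norm_inv, norm_norm, inv_mul_cancel₀ hpos.ne']
  refine ⟨ν, hν, fun μ hμ => ?_⟩
  have hc : 0 < μ 0 / ν 0 := div_pos_of_neg_of_neg hμ.outward hν.outward
  set c := μ 0 / ν 0 with hcdef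
  have hw0 : (μ - c • ν) 0 = 0 := by
    have : (μ - c • ν) 0 = μ 0 - c * ν 0 := rfl
    rw [this, hcdef, div_mul_cancel₀ _ hν.outward.ne, sub_self]
  have h1 := hμ.normal _ hw0
  have h2 := hν.normal _ hw0
  rw [← hD] at h1 h2
  have h3 : ⟪D (μ - c • ν), D (μ - c • ν)⟫ = 0 := by
    conv_lhs => rw [map_sub D μ, inner_sub_left, map_smul, real_inner_smul_left]
    rw [map_sub, map_smul] at h1 h2
    rw [h1, h2]; simp
  have h4 : μ = c • ν := sub_eq_zero.1 (hker _ (inner_self_eq_zero.1 h3))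
  have h5 := hμ.unit
  rw [h4, ← hD, map_smul, norm_smul, hD, hν.unit, mul_one, Real.norm_of_nonneg hc.le] at h5
  rw [h4, h5, one_smul]

end Submanifold

end

end SteklovBall

/-!
In local coordinates the Gauss formula says that `∂ᵢ∂ⱼ φ - Γˡᵢⱼ ∂ₗ φ` is the normal part of `∂ᵢ∂ⱼ φ`
(`starProjection_orthogonal_pd_pd`). Tracing with the inverse metric gives `Δ xᵃ = Hᵃ`
(`IsProperlyImmersedInBall.laplacian_coord`), so `φ` is minimal iff its coordinate functions are
harmonic.

At a boundary point `|φ|²` is maximal, hence `⟨dφ ν, φ⟩ ≥ 0`. As `dφ ν` and `φ` are unit vectors there,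
`dφ ν` is orthogonal to the tangent space `φ^⊥` of the sphere iff `dφ ν = φ`
(`IsProperlyImmersedInBall.meetsSphereOrthogonally_iff`), that is, iff every coordinate function has
normal derivative `∂ xᵃ / ∂ν = xᵃ`.

It remains to see that the normal derivative of `xᵃ` is the value of the Dirichlet-to-Neumann map. The
latter is defined through some harmonic extension of the boundary values, so when it is assumed that
`L xᵃ = xᵃ` uniqueness of the extension is needed
(`IsProperlyImmersedInBall.harmonicExtension_unique`). Since the coordinate functions are harmonic,
`Δ |φ|² = 2 k > 0`; this provides a strictly subharmonic function, so the weak maximum principle follows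
from the second derivative test alone, also if `M` has components without boundary.
-/

namespace SteklovBall

open Filter Topology Set

/-! ### Positive semidefinite matrices -/

open scoped MatrixOrder Matrix.Norms.L2Operator in
theorem exists_eq_conjTranspose_mul_self {ι : Type*} [Fintype ι] [DecidableEq ι]
    {A : Matrix ι ι ℝ} (hA : A.PosSemidef) :
    ∃ B : Matrix ι ι ℝ, A = B.conjTranspose * B :=
  CStarAlgebra.nonneg_iff_eq_star_mul_self.1 hA.nonneg

/-! ### Calculus on the closed half space -/

section HalfSpaceCalculus

variable {k : ℕ} [NeZero k] {F F' : Type*} [NormedAddCommGroup F] [NormedSpace ℝ F]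
  [NormedAddCommGroup F'] [NormedSpace ℝ F'] {f g : Euc k → F} {y : Euc k}

theorem uniqueDiffOn_halfSpace : UniqueDiffOn ℝ (halfSpace k) := (𝓡∂ k).uniqueDiffOn

theorem pd_congr (h : f =ᶠ[𝓝[halfSpace k] y] g) (hy : y ∈ halfSpace k) (i : Fin k) :
    pd i f y = pd i g y := by
  rw [pd, h.fderivWithin_eq_of_mem hy, pd]

theorem contDiffWithinAt_pd (hf : ContDiffWithinAt ℝ ∞ f (halfSpace k) y) (hy : y ∈ halfSpace k)
    (i : Fin k) : ContDiffWithinAt ℝ ∞ (pd i f) (halfSpace k) y :=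
  (hf.fderivWithin_right uniqueDiffOn_halfSpace (m := ∞) (by simp) hy).clm_apply
    contDiffWithinAt_const

theorem differentiableWithinAt_of_smooth (hf : ContDiffWithinAt ℝ ∞ f (halfSpace k) y) :
    DifferentiableWithinAt ℝ f (halfSpace k) y :=
  hf.differentiableWithinAt (by simp)

theorem eventually_differentiableWithinAt (hf : ContDiffWithinAt ℝ ∞ f (halfSpace k) y)
    (hy : y ∈ halfSpace k) :
    ∀ᶠ z in 𝓝[halfSpace k] y, DifferentiableWithinAt ℝ f (halfSpace k) z := by
  have h : ContDiffWithinAt ℝ 1 f (halfSpace k) y := hf.of_le (by exact_mod_cast le_top)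
  have h' := h.eventually (by simp)
  rw [insert_eq_of_mem hy] at h'
  exact h'.mono fun z hz => hz.differentiableWithinAt (by simp)

theorem pd_clm_comp (L : F →L[ℝ] F') (hf : DifferentiableWithinAt ℝ f (halfSpace k) y)
    (hy : y ∈ halfSpace k) (i : Fin k) : pd i (fun z => L (f z)) y = L (pd i f y) := by
  have h := (L.hasFDerivAt.comp_hasFDerivWithinAt y hf.hasFDerivWithinAt).fderivWithin
    (uniqueDiffOn_halfSpace y hy)
  exact congrArg (fun A : Euc k →L[ℝ] F' => A (EuclideanSpace.single i 1)) h

theorem pd_pd_clm_comp (L : F →L[ℝ] F') (hf : ContDiffWithinAt ℝ ∞ f (halfSpace k) y)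
    (hy : y ∈ halfSpace k) (i j : Fin k) :
    pd i (pd j fun z => L (f z)) y = L (pd i (pd j f) y) := by
  rw [← pd_clm_comp L (differentiableWithinAt_of_smooth (contDiffWithinAt_pd hf hy j)) hy]
  refine pd_congr ?_ hy i
  filter_upwards [eventually_differentiableWithinAt hf hy, self_mem_nhdsWithin] with z hz hzs
  exact pd_clm_comp L hz hzs j

theorem pd_inner {E : Type*} [NormedAddCommGroup E] [InnerProductSpace ℝ E] {f g : Euc k → E}
    (hf : DifferentiableWithinAt ℝ f (halfSpace k) y)
    (hg : DifferentiableWithinAt ℝ g (halfSpace k) y) (hy : y ∈ halfSpace k) (i : Fin k) :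
    pd i (fun z => ⟪f z, g z⟫) y = ⟪pd i f y, g y⟫ + ⟪f y, pd i g y⟫ := by
  have h := (hf.hasFDerivWithinAt.inner ℝ hg.hasFDerivWithinAt).fderivWithin
    (uniqueDiffOn_halfSpace y hy)
  have h' := congrArg (fun A : Euc k →L[ℝ] ℝ => A (EuclideanSpace.single i 1)) h
  refine h'.trans ?_
  simp [pd, add_comm]

theorem pd_pd_comm (hf : ContDiffWithinAt ℝ ∞ f (halfSpace k) y) (hy : y ∈ halfSpace k)
    (i j : Fin k) : pd i (pd j f) y = pd j (pd i f) y := by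
  have hd : DifferentiableWithinAt ℝ (fderivWithin ℝ f (halfSpace k)) (halfSpace k) y :=
    (hf.fderivWithin_right uniqueDiffOn_halfSpace (m := ∞) (by simp) hy).differentiableWithinAt
      (by simp)
  have key : ∀ i j : Fin k, pd i (pd j f) y =
      fderivWithin ℝ (fderivWithin ℝ f (halfSpace k)) (halfSpace k) y
        (EuclideanSpace.single i 1) (EuclideanSpace.single j 1) := fun i j =>
    pd_clm_comp (ContinuousLinearMap.apply ℝ F (EuclideanSpace.single j (1 : ℝ))) hd hy i
  rw [key, key]
  have hsmooth : minSmoothness ℝ 2 ≤ ∞ := by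
    rw [minSmoothness_of_isRCLikeNormedField]
    exact ENat.LEInfty.out
  exact (hf.isSymmSndFDerivWithinAt hsmooth uniqueDiffOn_halfSpace
    ((𝓡∂ k).range_subset_closure_interior hy) hy).eq _ _

/-- A derivative within the half space is determined by the partial derivatives. -/
theorem fderivWithin_apply_eq_sum_pd (c : Euc k) :
    fderivWithin ℝ f (halfSpace k) y c = ∑ i, c i • pd i f y := by
  have hc : c = ∑ i, c i • EuclideanSpace.single i (1 : ℝ) := by
    ext j
    simp [Finset.sum_apply, Pi.single_apply]
  conv_lhs => rw [hc]
  simp [map_sum, pd]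

theorem hasDerivAt_line {c : Euc k} {t : ℝ}
    (hf : DifferentiableWithinAt ℝ f (halfSpace k) (y + t • c))
    (hy : halfSpace k ∈ 𝓝 (y + t • c)) :
    HasDerivAt (fun s : ℝ => f (y + s • c)) (∑ i, c i • pd i f (y + t • c)) t := by
  have hl : HasDerivAt (fun s : ℝ => y + s • c) c t := by
    simpa using ((hasDerivAt_id t).smul_const c).const_add y
  have := (hf.hasFDerivWithinAt.hasFDerivAt hy).comp_hasDerivAt t hl
  rwa [fderivWithin_apply_eq_sum_pd] at this

/-- At an interior local maximum the gradient vanishes and the Hessian is negative semidefinite. -/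
theorem pd_eq_zero_and_hessian_nonpos_of_isLocalMax {U : Euc k → ℝ} (hmax : IsLocalMax U y)
    (hU : ContDiffWithinAt ℝ ∞ U (halfSpace k) y) (hy : halfSpace k ∈ 𝓝 y) :
    (∀ i, pd i U y = 0) ∧
      ∀ c : Fin k → ℝ, ∑ i, ∑ j, c i * c j * pd i (pd j U) y ≤ 0 := by
  have hys := mem_of_mem_nhds hy
  refine ⟨fun i => ?_, fun c' => ?_⟩
  · rw [pd, fderivWithin_of_mem_nhds hy, hmax.fderiv_eq_zero]; rfl
  set c : Euc k := WithLp.toLp 2 c' with hc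
  set h : ℝ → ℝ := fun s => U (y + s • c) with hh
  have hline : Tendsto (fun s : ℝ => y + s • c) (𝓝 0) (𝓝 y) := by
    have : Continuous fun s : ℝ => y + s • c := by fun_prop
    simpa using this.tendsto 0
  have hmax' : IsLocalMax h 0 := by
    have := hline.eventually hmax
    simpa [IsLocalMax, IsMaxFilter, hh] using this
  have hderiv : deriv h =ᶠ[𝓝 0] fun t => ∑ j, c j * pd j U (y + t • c) := by
    have h1 := eventually_differentiableWithinAt hU hys
    rw [nhdsWithin_eq_nhds.2 hy] at h1
    filter_upwards [hline.eventually h1, hline.eventually (eventually_mem_nhds_iff.2 hy)]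
      with t ht hts
    exact (hasDerivAt_line ht hts).deriv
  have hderiv2 : deriv (deriv h) 0 = ∑ i, ∑ j, c' i * c' j * pd i (pd j U) y := by
    rw [hderiv.deriv_eq]
    have : HasDerivAt (fun t : ℝ => ∑ j, c j * pd j U (y + t • c))
        (∑ j, c j * ∑ i, c i • pd i (pd j U) (y + (0 : ℝ) • c)) 0 :=
      HasDerivAt.fun_sum fun j _ => (hasDerivAt_line (f := pd j U) (y := y) (c := c) (t := 0)
        (by simpa using differentiableWithinAt_of_smooth (contDiffWithinAt_pd hU hys j))
        (by simpa using hy)).const_mul _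
    rw [this.deriv, Finset.sum_comm]
    simp only [zero_smul, add_zero, Finset.mul_sum, smul_eq_mul]
    refine Finset.sum_congr rfl fun j _ => Finset.sum_congr rfl fun i _ => ?_
    simp only [hc]; ring
  rw [← hderiv2]
  by_contra! hpos
  have hcont : ContinuousAt h 0 := by
    refine (hasDerivAt_line (y := y) (c := c) (t := 0) ?_ ?_).continuousAt
    · simpa using differentiableWithinAt_of_smooth hU
    · simpa using hy
  have hmin : IsLocalMin h 0 := isLocalMin_of_deriv_deriv_pos hpos hmax'.deriv_eq_zero hcont
  -- A local maximum that is also a local minimum makes `h` locally constant.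
  have hconst : h =ᶠ[𝓝 0] fun _ => h 0 := by
    filter_upwards [hmax', hmin] with t h1 h2 using le_antisymm h1 h2
  have h3 : deriv h =ᶠ[𝓝 0] fun _ => 0 := by
    filter_upwards [hconst.deriv] with t ht
    simpa using ht
  rw [h3.deriv_eq] at hpos
  simp at hpos

end HalfSpaceCalculus

/-! ### The Laplacian in coordinates -/

section CoordLaplacian

variable {k n : ℕ} [NeZero k] {y : Euc k}

/-- The metric `gᵢⱼ = ⟨∂ᵢ Φ, ∂ⱼ Φ⟩` induced by a map `Φ` on the half space. For the coordinate
expression of `φ` in the chart at `p` it is definitionally `inducedMetric k φ p`. -/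
noncomputable def pullbackMetric (Φ : Euc k → Euc n) : Euc k → Matrix (Fin k) (Fin k) ℝ :=
  fun z => Matrix.of fun i j => ⟪pd i Φ z, pd j Φ z⟫

theorem pullbackMetric_posDef {Φ : Euc k → Euc n}
    (h : Function.Injective (fderivWithin ℝ Φ (halfSpace k) y)) :
    (pullbackMetric Φ y).PosDef := by
  refine Matrix.posDef_gram_of_linearIndependent (𝕜 := ℝ) (v := fun i => pd i Φ y) ?_
  have hb : LinearIndependent ℝ fun i : Fin k => EuclideanSpace.single i (1 : ℝ) :=
    EuclideanSpace.orthonormal_single.linearIndependent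
  exact hb.map' (fderivWithin ℝ Φ (halfSpace k) y).toLinearMap (LinearMap.ker_eq_bot.2 h)

/-- The Christoffel symbols of an induced metric: `Γˡᵢⱼ = gˡᵐ ⟨∂ᵢ∂ⱼ Φ, ∂ₘ Φ⟩`. -/
theorem christoffel_pullbackMetric {Φ : Euc k → Euc n}
    (hΦ : ContDiffWithinAt ℝ ∞ Φ (halfSpace k) y) (hy : y ∈ halfSpace k) (l i j : Fin k) :
    christoffel (pullbackMetric Φ) y l i j =
      ∑ m, (pullbackMetric Φ y)⁻¹ l m * ⟪pd i (pd j Φ) y, pd m Φ y⟫ := by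
  have hd : ∀ a, DifferentiableWithinAt ℝ (pd a Φ) (halfSpace k) y := fun a =>
    differentiableWithinAt_of_smooth (contDiffWithinAt_pd hΦ hy a)
  have hG : ∀ a b c, pd a (fun z => pullbackMetric Φ z b c) y =
      ⟪pd a (pd b Φ) y, pd c Φ y⟫ + ⟪pd b Φ y, pd a (pd c Φ) y⟫ := fun a b c =>
    pd_inner (hd b) (hd c) hy a
  rw [christoffel, Finset.mul_sum]
  refine Finset.sum_congr rfl fun m _ => ?_
  rw [hG, hG, hG, pd_pd_comm hΦ hy j i, pd_pd_comm hΦ hy m i, pd_pd_comm hΦ hy m j,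
    real_inner_comm (pd i (pd m Φ) y) (pd j Φ y)]
  ring

/-- The Gauss formula: subtracting the Christoffel terms from `∂ᵢ∂ⱼ Φ` removes exactly its
tangential component. -/
theorem starProjection_orthogonal_pd_pd {Φ : Euc k → Euc n}
    (hΦ : ContDiffWithinAt ℝ ∞ Φ (halfSpace k) y) (hy : y ∈ halfSpace k)
    (hinj : Function.Injective (fderivWithin ℝ Φ (halfSpace k) y)) (i j : Fin k) :
    (LinearMap.range (fderivWithin ℝ Φ (halfSpace k) y).toLinearMap)ᗮ.starProjection
        (pd i (pd j Φ) y) =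
      pd i (pd j Φ) y - ∑ l, christoffel (pullbackMetric Φ) y l i j • pd l Φ y := by
  set G := pullbackMetric Φ with hG
  have hdet : IsUnit (G y).det := (pullbackMetric_posDef hinj).det_pos.ne'.isUnit
  have htan : ∑ l, christoffel G y l i j • pd l Φ y ∈
      LinearMap.range (fderivWithin ℝ Φ (halfSpace k) y).toLinearMap :=
    Submodule.sum_mem _ fun l _ => Submodule.smul_mem _ _ ⟨EuclideanSpace.single l 1, rfl⟩
  refine Submodule.eq_starProjection_of_mem_orthogonal ?_ ?_
  · rw [Submodule.mem_orthogonal']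
    rintro _ ⟨c, rfl⟩
    change ⟪_, fderivWithin ℝ Φ (halfSpace k) y c⟫ = 0
    rw [fderivWithin_apply_eq_sum_pd, inner_sum]
    refine Finset.sum_eq_zero fun m _ => ?_
    rw [real_inner_smul_right, inner_sub_left, sum_inner]
    have key : ∑ l, ⟪christoffel G y l i j • pd l Φ y, pd m Φ y⟫ =
        ((G y * (G y)⁻¹).mulVec fun a => ⟪pd i (pd j Φ) y, pd a Φ y⟫) m := by
      rw [← Matrix.mulVec_mulVec]
      refine Finset.sum_congr rfl fun l _ => ?_
      rw [real_inner_smul_left, hG, christoffel_pullbackMetric hΦ hy, real_inner_comm, mul_comm]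
      rfl
    rw [key, Matrix.mul_nonsing_inv _ hdet, Matrix.one_mulVec, sub_self, mul_zero]
  · rw [sub_sub_cancel]
    exact Submodule.le_orthogonal_orthogonal _ htan

/-- The Laplacian commutes with continuous linear functionals. On the right is the Laplacian of a
function with values in a normed space, since `coordLaplacian` is only defined for real values. -/
theorem coordLaplacian_clm_comp {F : Type*} [NormedAddCommGroup F] [NormedSpace ℝ F]
    (G : Euc k → Matrix (Fin k) (Fin k) ℝ) (L : F →L[ℝ] ℝ) {f : Euc k → F}
    (hf : ContDiffWithinAt ℝ ∞ f (halfSpace k) y) (hy : y ∈ halfSpace k) :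
    coordLaplacian G (fun z => L (f z)) y =
      L (∑ i, ∑ j, (G y)⁻¹ i j • (pd i (pd j f) y - ∑ l, christoffel G y l i j • pd l f y)) := by
  simp only [coordLaplacian, map_sum, map_smul, map_sub, smul_eq_mul, pd_pd_clm_comp L hf hy,
    pd_clm_comp L (differentiableWithinAt_of_smooth hf) hy]

theorem coordLaplacian_add_const_mul (G : Euc k → Matrix (Fin k) (Fin k) ℝ) {U V : Euc k → ℝ}
    (hU : ContDiffWithinAt ℝ ∞ U (halfSpace k) y) (hV : ContDiffWithinAt ℝ ∞ V (halfSpace k) y)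
    (hy : y ∈ halfSpace k) (a b : ℝ) :
    coordLaplacian G (fun z => a * U z + b * V z) y =
      a * coordLaplacian G U y + b * coordLaplacian G V y := by
  have hUV : ContDiffWithinAt ℝ ∞ (fun z => (U z, V z)) (halfSpace k) y := hU.prodMk hV
  let L₁ := ContinuousLinearMap.fst ℝ ℝ ℝ
  let L₂ := ContinuousLinearMap.snd ℝ ℝ ℝ
  have h := coordLaplacian_clm_comp G (a • L₁ + b • L₂) hUV hy
  have h₁ := coordLaplacian_clm_comp G L₁ hUV hy
  have h₂ := coordLaplacian_clm_comp G L₂ hUV hy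
  refine h.trans ?_
  simp only [add_apply, smul_apply, smul_eq_mul]
  rw [← h₁, ← h₂]
  rfl

/-- For the metric induced by `Φ`, `Δ |Φ|² = 2 gⁱʲ ⟨∂ᵢ Φ, ∂ⱼ Φ⟩ + 2 ⟨Φ, Δ Φ⟩ = 2 k + 2 ⟨Φ, Δ Φ⟩`, and
the last term vanishes when the components of `Φ` are harmonic. -/
theorem coordLaplacian_norm_sq {Φ : Euc k → Euc n}
    (hΦ : ContDiffWithinAt ℝ ∞ Φ (halfSpace k) y) (hy : y ∈ halfSpace k)
    (hinj : Function.Injective (fderivWithin ℝ Φ (halfSpace k) y))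
    (hharm : ∀ a, coordLaplacian (pullbackMetric Φ) (fun z => Φ z a) y = 0) :
    coordLaplacian (pullbackMetric Φ) (fun z => ⟪Φ z, Φ z⟫) y = 2 * k := by
  set G := pullbackMetric Φ with hG
  have hpd : IsUnit (G y).det := (pullbackMetric_posDef hinj).det_pos.ne'.isUnit
  have hd : DifferentiableWithinAt ℝ Φ (halfSpace k) y := differentiableWithinAt_of_smooth hΦ
  have h1 : ∀ z ∈ halfSpace k, DifferentiableWithinAt ℝ Φ (halfSpace k) z → ∀ j,
      pd j (fun z => ⟪Φ z, Φ z⟫) z = 2 * ⟪Φ z, pd j Φ z⟫ := fun z hz hdz j => by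
    rw [pd_inner hdz hdz hz, real_inner_comm]; ring
  have h2 : ∀ i j, pd i (pd j fun z => ⟪Φ z, Φ z⟫) y =
      2 * (G y i j + ⟪Φ y, pd i (pd j Φ) y⟫) := fun i j => by
    have hdj := differentiableWithinAt_of_smooth (contDiffWithinAt_pd hΦ hy j)
    have : pd j (fun z => ⟪Φ z, Φ z⟫) =ᶠ[𝓝[halfSpace k] y]
        fun z => (2 : ℝ) • ContinuousLinearMap.id ℝ ℝ ⟪Φ z, pd j Φ z⟫ := by
      filter_upwards [eventually_differentiableWithinAt hΦ hy, self_mem_nhdsWithin] with z hz hzs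
      exact h1 z hzs hz j
    rw [pd_congr this hy]
    refine (pd_clm_comp ((2 : ℝ) • ContinuousLinearMap.id ℝ ℝ) (hd.inner ℝ hdj) hy i).trans ?_
    rw [pd_inner hd hdj hy]
    rfl
  have hvec : (∑ i, ∑ j, (G y)⁻¹ i j •
      (pd i (pd j Φ) y - ∑ l, christoffel G y l i j • pd l Φ y)) = 0 := by
    ext a
    exact (coordLaplacian_clm_comp G (EuclideanSpace.proj a) hΦ hy).symm.trans (hharm a)
  have htrace : ∑ i, ∑ j, (G y)⁻¹ i j * G y i j = k := by
    have hsymm : ∀ i j, G y i j = G y j i := fun i j =>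
      real_inner_comm (pd j Φ y) (pd i Φ y)
    calc ∑ i, ∑ j, (G y)⁻¹ i j * G y i j = ((G y)⁻¹ * G y).trace := by
          refine Finset.sum_congr rfl fun i _ => Finset.sum_congr rfl fun j _ => ?_
          rw [hsymm i j]
      _ = k := by rw [Matrix.nonsing_inv_mul _ hpd, Matrix.trace_one, Fintype.card_fin]
  have hsplit : coordLaplacian G (fun z => ⟪Φ z, Φ z⟫) y =
      2 * ∑ i, ∑ j, (G y)⁻¹ i j * G y i j + 2 * ⟪Φ y, ∑ i, ∑ j, (G y)⁻¹ i j •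
        (pd i (pd j Φ) y - ∑ l, christoffel G y l i j • pd l Φ y)⟫ := by
    simp only [coordLaplacian, h2, h1 y hy hd, inner_sum, inner_sub_right, real_inner_smul_right,
      Finset.mul_sum, ← Finset.sum_add_distrib]
    refine Finset.sum_congr rfl fun i _ => Finset.sum_congr rfl fun j _ => ?_
    have : ∑ l, christoffel G y l i j * (2 * ⟪Φ y, pd l Φ y⟫) =
        2 * ∑ l, christoffel G y l i j * ⟪Φ y, pd l Φ y⟫ := by
      rw [Finset.mul_sum]
      exact Finset.sum_congr rfl fun l _ => by ring
    rw [this]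
    ring
  rw [hsplit, hvec, htrace, inner_zero_right, mul_zero, add_zero]

/-- At an interior local maximum the Laplacian of any Riemannian metric is nonpositive. -/
theorem coordLaplacian_nonpos_of_isLocalMax {G : Euc k → Matrix (Fin k) (Fin k) ℝ} {U : Euc k → ℝ}
    (hmax : IsLocalMax U y) (hU : ContDiffWithinAt ℝ ∞ U (halfSpace k) y)
    (hy : halfSpace k ∈ 𝓝 y) (hG : (G y).PosDef) : coordLaplacian G U y ≤ 0 := by
  obtain ⟨hgrad, hhess⟩ := pd_eq_zero_and_hessian_nonpos_of_isLocalMax hmax hU hy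
  obtain ⟨B, hB⟩ := exists_eq_conjTranspose_mul_self hG.inv.posSemidef
  -- `g⁻¹ = Bᵀ B` turns the trace into a sum of values of the Hessian on the rows of `B`.
  have hexp : ∀ i j, (G y)⁻¹ i j = ∑ r, B r i * B r j := fun i j => by
    rw [hB]; simp [Matrix.mul_apply]
  have : coordLaplacian G U y = ∑ r, ∑ i, ∑ j, B r i * B r j * pd i (pd j U) y := by
    simp only [coordLaplacian, hgrad, mul_zero, Finset.sum_const_zero, sub_zero, hexp,
      Finset.sum_mul]
    rw [Finset.sum_comm_cycle]
  rw [this]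
  exact Finset.sum_nonpos fun r _ => hhess (B r)

end CoordLaplacian

/-! ### Transfer to the manifold -/

section Manifold

variable {k n : ℕ} [NeZero k] {M : Type*} [TopologicalSpace M]
  [ChartedSpace (EuclideanHalfSpace k) M] {φ : M → Euc n}

theorem coordsAt_mem_halfSpace (p : M) : coordsAt k p ∈ halfSpace k :=
  extChartAt_target_subset_range p (mem_extChartAt_target p)

theorem inChart_coordsAt {F : Type*} (f : M → F) (p : M) : inChart k p f (coordsAt k p) = f p :=
  congrArg f (extChartAt_to_inv p)

theorem contDiffWithinAt_inChart {F : Type*} [NormedAddCommGroup F] [NormedSpace ℝ F] {f : M → F}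
    (hf : ContMDiff (𝓡∂ k) 𝓘(ℝ, F) ∞ f) (p : M) :
    ContDiffWithinAt ℝ ∞ (inChart k p f) (halfSpace k) (coordsAt k p) :=
  (contMDiffAt_iff.1 (hf p)).2

theorem mfderiv_eq_fderivWithin_inChart {F : Type*} [NormedAddCommGroup F] [NormedSpace ℝ F]
    {f : M → F} (hf : ContMDiff (𝓡∂ k) 𝓘(ℝ, F) ∞ f) (p : M) :
    mfderiv (𝓡∂ k) 𝓘(ℝ, F) f p =
      fderivWithin ℝ (inChart k p f) (halfSpace k) (coordsAt k p) :=
  ((hf p).mdifferentiableAt (by simp)).mfderiv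

theorem differential_eq (hφ : ContMDiff (𝓡∂ k) 𝓘(ℝ, Euc n) ∞ φ) (p : M) :
    differential k φ p = fderivWithin ℝ (inChart k p φ) (halfSpace k) (coordsAt k p) :=
  mfderiv_eq_fderivWithin_inChart hφ p

theorem contMDiff_clm_comp {F F' : Type*} [NormedAddCommGroup F] [NormedSpace ℝ F]
    [NormedAddCommGroup F'] [NormedSpace ℝ F'] (L : F →L[ℝ] F') {f : M → F}
    (hf : ContMDiff (𝓡∂ k) 𝓘(ℝ, F) ∞ f) : ContMDiff (𝓡∂ k) 𝓘(ℝ, F') ∞ fun p => L (f p) :=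
  L.contDiff.contMDiff.comp hf

theorem dirDeriv_clm_comp (L : Euc n →L[ℝ] ℝ) (hφ : ContMDiff (𝓡∂ k) 𝓘(ℝ, Euc n) ∞ φ) (p : M)
    (ν : Euc k) : dirDeriv k (fun q => L (φ q)) p ν = L (differential k φ p ν) := by
  have h := (L.hasFDerivAt.comp_hasFDerivWithinAt (coordsAt k p)
    (differentiableWithinAt_of_smooth
      (contDiffWithinAt_inChart hφ p)).hasFDerivWithinAt).fderivWithin
    (uniqueDiffOn_halfSpace _ (coordsAt_mem_halfSpace p))
  rw [dirDeriv, mfderiv_eq_fderivWithin_inChart (contMDiff_clm_comp L hφ), differential_eq hφ]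
  exact congrArg (fun A : Euc k →L[ℝ] ℝ => A ν) h

theorem IsProperlyImmersedInBall.injective_fderivWithin (hφ : IsProperlyImmersedInBall k φ)
    (p : M) :
    Function.Injective (fderivWithin ℝ (inChart k p φ) (halfSpace k) (coordsAt k p)) := by
  rw [← differential_eq hφ.smooth]
  exact hφ.injective_differential p

theorem IsProperlyImmersedInBall.inner_self_le (hφ : IsProperlyImmersedInBall k φ) (p : M) :
    ⟪φ p, φ p⟫ ≤ 1 := by
  have := mem_closedBall_zero_iff.1 (hφ.mem_ball p)
  rw [real_inner_self_eq_norm_sq]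
  exact pow_le_one₀ (norm_nonneg _) this

theorem IsProperlyImmersedInBall.norm_eq_one (hφ : IsProperlyImmersedInBall k φ) {p : M}
    (hp : p ∈ (𝓡∂ k).boundary M) : ‖φ p‖ = 1 :=
  mem_sphere_zero_iff_norm.1 (hφ.boundary_mem_sphere p hp)

/-- Beltrami's formula `Δ xᵃ = Hᵃ`: the Laplacian of a coordinate function is the corresponding
component of the mean curvature vector. -/
theorem IsProperlyImmersedInBall.laplacian_coord (hφ : IsProperlyImmersedInBall k φ) (p : M)
    (a : Fin n) : laplacian k φ (fun q => φ q a) p = meanCurvature k φ p a := by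
  have hs := contDiffWithinAt_inChart hφ.smooth p
  have hy := coordsAt_mem_halfSpace (k := k) p
  have hH : meanCurvature k φ p = ∑ i, ∑ j, (inducedMetric k φ p (coordsAt k p))⁻¹ i j •
      (pd i (pd j (inChart k p φ)) (coordsAt k p) -
        ∑ l, christoffel (inducedMetric k φ p) (coordsAt k p) l i j •
          pd l (inChart k p φ) (coordsAt k p)) := by
    refine Finset.sum_congr rfl fun i _ => Finset.sum_congr rfl fun j _ => ?_
    have h := starProjection_orthogonal_pd_pd hs hy (hφ.injective_fderivWithin p) i j
    rw [← differential_eq hφ.smooth] at h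
    exact congrArg _ h
  rw [hH]
  exact coordLaplacian_clm_comp (inducedMetric k φ p) (EuclideanSpace.proj a) hs hy

theorem IsProperlyImmersedInBall.isMinimal_iff (hφ : IsProperlyImmersedInBall k φ) :
    IsMinimal k φ ↔ ∀ a p, laplacian k φ (fun q => φ q a) p = 0 := by
  simp only [hφ.laplacian_coord]
  refine ⟨fun h a p => by rw [h p]; rfl, fun h p => ?_⟩
  ext a
  exact h a p

theorem laplacian_add_const_mul {u v : M → ℝ} (hu : ContMDiff (𝓡∂ k) 𝓘(ℝ, ℝ) ∞ u)
    (hv : ContMDiff (𝓡∂ k) 𝓘(ℝ, ℝ) ∞ v) (a b : ℝ) (p : M) :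
    laplacian k φ (fun q => a * u q + b * v q) p = a * laplacian k φ u p + b * laplacian k φ v p :=
  coordLaplacian_add_const_mul _ (contDiffWithinAt_inChart hu p) (contDiffWithinAt_inChart hv p)
    (coordsAt_mem_halfSpace p) a b

theorem contMDiff_add_const_mul {u v : M → ℝ} (hu : ContMDiff (𝓡∂ k) 𝓘(ℝ, ℝ) ∞ u)
    (hv : ContMDiff (𝓡∂ k) 𝓘(ℝ, ℝ) ∞ v) (a b : ℝ) :
    ContMDiff (𝓡∂ k) 𝓘(ℝ, ℝ) ∞ fun q => a * u q + b * v q :=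
  (contMDiff_const.mul hu).add (contMDiff_const.mul hv)

theorem contMDiff_inner_self (hφ : ContMDiff (𝓡∂ k) 𝓘(ℝ, Euc n) ∞ φ) :
    ContMDiff (𝓡∂ k) 𝓘(ℝ, ℝ) ∞ fun p => ⟪φ p, φ p⟫ :=
  (contDiff_id.inner ℝ contDiff_id : ContDiff ℝ ∞ fun x : Euc n => ⟪x, x⟫).contMDiff.comp hφ

/-- On a minimal submanifold `|φ|²` is strictly subharmonic. -/
theorem IsProperlyImmersedInBall.laplacian_norm_sq (hφ : IsProperlyImmersedInBall k φ)
    (hmin : IsMinimal k φ) (p : M) : laplacian k φ (fun q => ⟪φ q, φ q⟫) p = 2 * k :=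
  coordLaplacian_norm_sq (contDiffWithinAt_inChart hφ.smooth p) (coordsAt_mem_halfSpace p)
    (hφ.injective_fderivWithin p) fun a => hφ.isMinimal_iff.1 hmin a p

/-- A global maximum at which the Laplacian is positive lies on the boundary. -/
theorem IsProperlyImmersedInBall.mem_boundary_of_isMax (hφ : IsProperlyImmersedInBall k φ)
    {u : M → ℝ} (hu : ContMDiff (𝓡∂ k) 𝓘(ℝ, ℝ) ∞ u) {p : M} (hmax : ∀ q, u q ≤ u p)
    (hpos : 0 < laplacian k φ u p) : p ∈ (𝓡∂ k).boundary M := by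
  by_contra hp
  have hint : (𝓡∂ k).IsInteriorPoint p :=
    ((𝓡∂ k).isInteriorPoint_iff_not_isBoundaryPoint p).2 hp
  have hloc : IsLocalMax (inChart k p u) (coordsAt k p) := Eventually.of_forall fun y => by
    rw [inChart_coordsAt]
    exact hmax _
  refine hpos.not_ge (coordLaplacian_nonpos_of_isLocalMax hloc (contDiffWithinAt_inChart hu p)
    (mem_interior_iff_mem_nhds.1 hint) ?_)
  exact pullbackMetric_posDef (hφ.injective_fderivWithin p)

/-- The weak maximum principle on a compact minimal submanifold of the ball: a harmonic function that
vanishes on the boundary is nonpositive. Adding `ε |φ|²` makes the function strictly subharmonic and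
raises its boundary values by at most `ε`. -/
theorem IsProperlyImmersedInBall.nonpos_of_harmonic [CompactSpace M]
    (hφ : IsProperlyImmersedInBall k φ) (hmin : IsMinimal k φ) {u : M → ℝ}
    (hu : ContMDiff (𝓡∂ k) 𝓘(ℝ, ℝ) ∞ u) (hharm : ∀ p, laplacian k φ u p = 0)
    (hbd : ∀ p ∈ (𝓡∂ k).boundary M, u p = 0) (p : M) : u p ≤ 0 := by
  refine le_of_forall_pos_le_add fun ε hε => ?_
  rw [zero_add]
  set v : M → ℝ := fun q => 1 * u q + ε * ⟪φ q, φ q⟫ with hv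
  have hsq := contMDiff_inner_self hφ.smooth
  have hvs : ContMDiff (𝓡∂ k) 𝓘(ℝ, ℝ) ∞ v := contMDiff_add_const_mul hu hsq 1 ε
  obtain ⟨q, -, hq⟩ := isCompact_univ.exists_isMaxOn ⟨p, mem_univ p⟩ hvs.continuous.continuousOn
  have hmax : ∀ r, v r ≤ v q := fun r => hq (mem_univ r)
  have hk : (0 : ℝ) < k := Nat.cast_pos.2 (NeZero.pos k)
  have hqb : q ∈ (𝓡∂ k).boundary M := by
    refine hφ.mem_boundary_of_isMax hvs hmax ?_
    rw [hv, laplacian_add_const_mul hu hsq, hharm, hφ.laplacian_norm_sq hmin]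
    positivity
  have h1 : v q ≤ ε := by
    have := hφ.inner_self_le q
    simp only [hv, hbd q hqb]
    nlinarith
  have h2 : u p ≤ v p := by
    have : 0 ≤ ε * ⟪φ p, φ p⟫ := mul_nonneg hε.le real_inner_self_nonneg
    simp only [hv]
    linarith
  exact h2.trans ((hmax p).trans h1)

/-- Uniqueness for the Dirichlet problem on a compact minimal submanifold of the ball. -/
theorem IsProperlyImmersedInBall.harmonicExtension_unique [CompactSpace M]
    (hφ : IsProperlyImmersedInBall k φ) (hmin : IsMinimal k φ)
    {b : (𝓡∂ k).boundary M → ℝ} {u w : M → ℝ} (hu : IsHarmonicExtension k φ b u)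
    (hw : IsHarmonicExtension k φ b w) : u = w := by
  have key : ∀ {u w : M → ℝ}, IsHarmonicExtension k φ b u → IsHarmonicExtension k φ b w →
      ∀ p, u p ≤ w p := fun {u w} hu hw p => by
    have h := hφ.nonpos_of_harmonic hmin (contMDiff_add_const_mul hu.smooth hw.smooth 1 (-1))
      (fun q => by
        rw [laplacian_add_const_mul hu.smooth hw.smooth, hu.harmonic, hw.harmonic]; ring)
      (fun q hq => by
        have : u q = w q := congrFun (hu.boundary_eq.trans hw.boundary_eq.symm) ⟨q, hq⟩
        rw [this]; ring) p
    linarith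
  exact funext fun p => le_antisymm (key hu hw p) (key hw hu p)

/-- The outward conormal makes an angle of at most `π / 2` with the position vector, because `|φ|²`
attains its maximum on `M` at every boundary point. -/
theorem IsProperlyImmersedInBall.inner_differential_conormal_nonneg
    (hφ : IsProperlyImmersedInBall k φ) {p : M} (hp : p ∈ (𝓡∂ k).boundary M) {ν : Euc k}
    (hν : IsOutwardConormal k φ p ν) : 0 ≤ ⟪differential k φ p ν, φ p⟫ := by
  have hd := (differentiableWithinAt_of_smooth
    (contDiffWithinAt_inChart hφ.smooth p)).hasFDerivWithinAt
  have hy := coordsAt_mem_halfSpace (k := k) p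
  have hmax : IsLocalMaxOn (fun z => ⟪inChart k p φ z, inChart k p φ z⟫) (halfSpace k)
      (coordsAt k p) := Eventually.of_forall fun z => by
    change _ ≤ ⟪inChart k p φ (coordsAt k p), inChart k p φ (coordsAt k p)⟫
    rw [inChart_coordsAt, real_inner_self_eq_norm_sq (φ p), hφ.norm_eq_one hp, one_pow]
    exact hφ.inner_self_le _
  have hcone : -ν ∈ posTangentConeAt (halfSpace k) (coordsAt k p) := by
    refine mem_posTangentConeAt_of_segment_subset ((𝓡∂ k).convex_range.segment_subset hy ?_)
    change coordsAt k p ∈ range (𝓡∂ k) at hy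
    rw [range_modelWithCornersEuclideanHalfSpace] at hy ⊢
    have h0 : (0 : ℝ) ≤ coordsAt k p 0 := hy
    have h1 := hν.outward
    change 0 ≤ coordsAt k p 0 + -(ν 0)
    linarith
  have h := hmax.hasFDerivWithinAt_nonpos (hd.inner ℝ hd) hcone
  rw [← differential_eq hφ.smooth] at h
  simp only [ContinuousLinearMap.comp_apply, ContinuousLinearMap.prod_apply, fderivInnerCLM_apply,
    map_neg, inChart_coordsAt] at h
  rw [real_inner_comm] at h
  linarith

/-- The submanifold meets the sphere orthogonally iff its outward conormal is the position vector,
which is the outward unit normal of the sphere. -/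
theorem IsProperlyImmersedInBall.meetsSphereOrthogonally_iff
    (hφ : IsProperlyImmersedInBall k φ) :
    MeetsSphereOrthogonally k φ ↔ ∀ p ∈ (𝓡∂ k).boundary M, ∀ ν : Euc k,
      IsOutwardConormal k φ p ν → differential k φ p ν = φ p := by
  refine ⟨fun h p hp ν hν => ?_, fun h p hp ν hν v hv => ?_⟩
  · set X := differential k φ p ν with hX
    set c := ⟪X, φ p⟫ with hc
    have hx : ⟪φ p, φ p⟫ = 1 := by
      rw [real_inner_self_eq_norm_sq, hφ.norm_eq_one hp, one_pow]
    -- `X - c φ p` is both tangent to the sphere and, by assumption, orthogonal to `X`.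
    have h0 : ⟪X - c • φ p, φ p⟫ = 0 := by
      rw [inner_sub_left, real_inner_smul_left, hx, mul_one, sub_self]
    have h1 : ⟪X, X - c • φ p⟫ = 0 := h p hp ν hν _ h0
    have hXX : ⟪X, X⟫ = 1 := by rw [real_inner_self_eq_norm_sq, hν.unit, one_pow]
    rw [inner_sub_right, real_inner_smul_right, hXX, ← hc] at h1
    have hc0 : 0 ≤ c := hφ.inner_differential_conormal_nonneg hp hν
    have hc1 : c = 1 := by nlinarith
    exact (inner_eq_one_iff_of_norm_eq_one hν.unit (hφ.norm_eq_one hp)).1 hc1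
  · rw [h p hp ν hν, real_inner_comm, hv]

end Manifold

end SteklovBall

theorem lemma2p1 {k n : ℕ} [NeZero k] {M : Type*} [TopologicalSpace M] [T2Space M]
    [CompactSpace M] [ChartedSpace (EuclideanHalfSpace k) M] [IsManifold (𝓡∂ k) ∞ M]
    (h_boundary : ((𝓡∂ k).boundary M).Nonempty)
    (φ : M → SteklovBall.Euc n) (hφ : SteklovBall.IsProperlyImmersedInBall k φ) :
    (SteklovBall.IsMinimal k φ ∧ SteklovBall.MeetsSphereOrthogonally k φ) ↔
      ∀ i : Fin n, SteklovBall.IsSteklovEigenfunction k φ 1 (fun p => φ p i) := by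
  have hderiv : ∀ (i : Fin n) (p : M) (ν : SteklovBall.Euc k),
      SteklovBall.dirDeriv k (fun q => φ q i) p ν = SteklovBall.differential k φ p ν i :=
    fun i p ν => SteklovBall.dirDeriv_clm_comp (EuclideanSpace.proj i) hφ.smooth p ν
  rw [hφ.isMinimal_iff, hφ.meetsSphereOrthogonally_iff]
  constructor
  · rintro ⟨hharm, horth⟩ i
    have hext : SteklovBall.IsHarmonicExtension k φ
        (SteklovBall.boundaryValues k fun q => φ q i) fun q => φ q i :=
      ⟨SteklovBall.contMDiff_clm_comp (EuclideanSpace.proj i) hφ.smooth, hharm i, rfl⟩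
    refine ⟨hext, _, hext, fun p ν hν => ?_⟩
    rw [hderiv, horth p p.2 ν hν, one_smul]
    rfl
  · intro h
    have hharm := fun i => (h i).1.harmonic
    refine ⟨hharm, fun p hp ν hν => ?_⟩
    ext i
    obtain ⟨hext, w, hw, hwν⟩ := h i
    -- The extension `w` in the definition of the Dirichlet-to-Neumann map is the coordinate itself.
    obtain rfl := hφ.harmonicExtension_unique (hφ.isMinimal_iff.2 hharm) hw hext
    rw [← hderiv, hwν ⟨p, hp⟩ ν hν, one_smul]
    rfl
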